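/- Let $M$ be a smooth (Hausdorff, $\sigma$-compact, finite-dimensional) manifold and let $(\mathcal A,\rho,[\cdot,\cdot])$ be a Lie algebroid over $M$, i.e. a smooth finite-rank real vector bundle $\mathcal A\to M$ with a Lie bracket on $\Gamma(\mathcal A)$ and a smooth bundle map $\rho:\mathcal A\to TM$ such that $\rho([S,T])=[\rho(S),\rho(T)]$ and $[S,fT]=f[S,T]+(\rho(S)\cdot f)\,T$. Let $(\omega,J,g)$ be a compatible triple on $\mathcal A$: $\omega$ is a closed ($d^{\mathcal A}\omega=0$) nondegenerate 2-form on $\mathcal A$, $J$ is a smooth bundle endomorphism of $\mathcal A$ with $J^2=-\mathrm{id}$, and $g$ is a Riemannian metric on $\mathcal A$, with $g(JS,JT)=g(S,T)$ and $\omega(S,T)=g(S,JT)$. For $f\in C^\infty(M)$ let $a_f\in\Gamma(\mathcal A)$ be its Hamiltonian section, the unique section with $df(\rho(b))=\omega(a_f,b)$ for all $b$, and put $\{f,h\}:=\omega(a_f,a_h)$. For $p\in M$ let $L_p=\ker\rho_p$, let $V^\omega$ denote the $\omega$-orthogonal complement of a subspace $V\subseteq\mathcal A_p$, and set $L^1_p=L_p\cap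 L_p^\omega$, $E^1_p=J(L^1_p)$, $E^2_p=(L_p+E^1_p)^\omega$. The symplectic generalized distribution is $\Lambda_p=\rho(E^2_p+L^1_p)\subseteq T_pM$. Let $x\in M$ and let $\mathcal O_x\subseteq M$ be an integral submanifold of $\Lambda$ through $x$, that is, an injectively immersed smooth submanifold containing $x$ with $T_y\mathcal O_x=\Lambda_y$ for every $y\in\mathcal O_x$ (for instance the maximal connected one). If $f\in C^\infty(M)$ is constant on $\mathcal O_x$, then $$\{f,h\}(y)=0\qquad\text{for every } h\in C^\infty(M)\text{ and every } y\in\mathcal O_x .$$ -/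

import Mathlib

open Set Bundle Manifold
open scoped Manifold ContDiff

noncomputable section

section LieAlgebroid

variable {E : Type*} [NormedAddCommGroup E] [NormedSpace ℝ E] [FiniteDimensional ℝ E]
  {H : Type*} [TopologicalSpace H] (I : ModelWithCorners ℝ E H)
  {M : Type*} [TopologicalSpace M] [ChartedSpace H M] [IsManifold I ∞ M]
  (F : Type*) [NormedAddCommGroup F] [NormedSpace ℝ F] [FiniteDimensional ℝ F]
  (A : M → Type*) [TopologicalSpace (TotalSpace F A)]
  [∀ x, TopologicalSpace (A x)] [∀ x, AddCommGroup (A x)] [∀ x, Module ℝ (A x)]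
  [∀ x, IsTopologicalAddGroup (A x)] [∀ x, ContinuousSMul ℝ (A x)]
  [FiberBundle F A] [VectorBundle ℝ F A] [ContMDiffVectorBundle ∞ F A I]

/-- The derivative of a real function `φ` at `x` in the direction `v`. -/
def dirDeriv (φ : M → ℝ) (x : M) (v : TangentSpace I x) : ℝ := mfderiv I 𝓘(ℝ, ℝ) φ x v

/-- The product `f • s` of a smooth function and a smooth section. -/
def smulSection {I : ModelWithCorners ℝ E H} {F : Type*} [NormedAddCommGroup F] [NormedSpace ℝ F]
    {A : M → Type*} [TopologicalSpace (TotalSpace F A)]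
    [∀ x, TopologicalSpace (A x)] [∀ x, AddCommGroup (A x)] [∀ x, Module ℝ (A x)]
    [FiberBundle F A] [VectorBundle ℝ F A]
    (f : C^∞⟮I, M; 𝓘(ℝ, ℝ), ℝ⟯) (s : Cₛ^∞⟮I; F, A⟯) : Cₛ^∞⟮I; F, A⟯ :=
  ⟨fun x => f x • s x, f.contMDiff.smul_section s.contMDiff⟩

/-- A Lie algebroid structure on the smooth vector bundle `A → M` (with model fibre `F`): a smooth
bundle map `ρ : A → TM` (the anchor) and a Lie bracket on the real vector space `Γ(A)` of smooth
sections such that `ρ` is a homomorphism into vector fields and the Leibniz identity holds. -/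
structure LieAlgebroid where
  /-- the anchor map -/
  anchor (x : M) : A x →L[ℝ] TangentSpace I x
  contMDiff_anchor : ContMDiff I (I.prod 𝓘(ℝ, F →L[ℝ] E)) ∞
    (fun x => TotalSpace.mk' (F →L[ℝ] E) (E := fun x : M => A x →L[ℝ] TangentSpace I x)
      x (anchor x))
  /-- the bracket of sections, as an `ℝ`-bilinear map -/
  bracket : Cₛ^∞⟮I; F, A⟯ →ₗ[ℝ] Cₛ^∞⟮I; F, A⟯ →ₗ[ℝ] Cₛ^∞⟮I; F, A⟯
  bracket_self (s : Cₛ^∞⟮I; F, A⟯) : bracket s s = 0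
  jacobi (s t u : Cₛ^∞⟮I; F, A⟯) :
    bracket s (bracket t u) + bracket t (bracket u s) + bracket u (bracket s t) = 0
  anchor_bracket (s t : Cₛ^∞⟮I; F, A⟯) (x : M) :
    anchor x (bracket s t x) =
      VectorField.mlieBracket I (fun y => anchor y (s y)) (fun y => anchor y (t y)) x
  leibniz (s t : Cₛ^∞⟮I; F, A⟯) (f : C^∞⟮I, M; 𝓘(ℝ, ℝ), ℝ⟯) (x : M) :
    bracket s (smulSection f t) x =
      f x • bracket s t x + dirDeriv I f x (anchor x (s x)) • t x

variable {I F A}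

namespace LieAlgebroid

variable (𝒜 : LieAlgebroid I F A)

/-- The derivative `ρ(s)·φ` of a real function along the anchor of a section. -/
def anchorDeriv (s : Cₛ^∞⟮I; F, A⟯) (φ : M → ℝ) (x : M) : ℝ :=
  dirDeriv I φ x (𝒜.anchor x (s x))

/-- The Lie algebroid exterior derivative `dΩ(s₀, s₁, s₂)` of a 2-form `Ω`. -/
def extDerivTwo (Ω : ∀ x, A x →L[ℝ] A x →L[ℝ] ℝ) (s₀ s₁ s₂ : Cₛ^∞⟮I; F, A⟯) (x : M) : ℝ :=
  𝒜.anchorDeriv s₀ (fun y => Ω y (s₁ y) (s₂ y)) x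
    - 𝒜.anchorDeriv s₁ (fun y => Ω y (s₀ y) (s₂ y)) x
    + 𝒜.anchorDeriv s₂ (fun y => Ω y (s₀ y) (s₁ y)) x
    - Ω x (𝒜.bracket s₀ s₁ x) (s₂ x)
    + Ω x (𝒜.bracket s₀ s₂ x) (s₁ x)
    - Ω x (𝒜.bracket s₁ s₂ x) (s₀ x)

/-- The isotropy `L_x = ker ρ_x`. -/
def isotropy (x : M) : Submodule ℝ (A x) := LinearMap.ker (𝒜.anchor x : A x →ₗ[ℝ] TangentSpace I x)

/-- A symplectic form on a Lie algebroid: a smooth, closed, nondegenerate 2-form. -/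
structure SymplecticForm where
  /-- the underlying family of bilinear forms -/
  form (x : M) : A x →L[ℝ] A x →L[ℝ] ℝ
  contMDiff_form : ContMDiff I (I.prod 𝓘(ℝ, F →L[ℝ] F →L[ℝ] ℝ)) ∞
    (fun x => TotalSpace.mk' (F →L[ℝ] F →L[ℝ] ℝ) (E := fun x : M => A x →L[ℝ] A x →L[ℝ] ℝ)
      x (form x))
  form_self (x : M) (v : A x) : form x v v = 0
  nondegenerate (x : M) (v : A x) (hv : ∀ w : A x, form x v w = 0) : v = 0
  closed (s₀ s₁ s₂ : Cₛ^∞⟮I; F, A⟯) (x : M) : 𝒜.extDerivTwo form s₀ s₁ s₂ x = 0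

end LieAlgebroid

variable (I F A) in
/-- An almost complex structure on `A`: a smooth bundle endomorphism `J` with `J² = -id`. -/
structure AlmostComplexStructure where
  /-- the underlying family of endomorphisms -/
  J (x : M) : A x →L[ℝ] A x
  contMDiff_J : ContMDiff I (I.prod 𝓘(ℝ, F →L[ℝ] F)) ∞
    (fun x => TotalSpace.mk' (F →L[ℝ] F) (E := fun x : M => A x →L[ℝ] A x) x (J x))
  J_J (x : M) (v : A x) : J x (J x v) = -v

namespace LieAlgebroid

namespace SymplecticForm

variable {𝒜 : LieAlgebroid I F A} (Ω : 𝒜.SymplecticForm)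

/-- The symplectic complement `V^Ω` of a subspace `V` of `A_x`. -/
def complement (x : M) (V : Submodule ℝ (A x)) : Submodule ℝ (A x) where
  carrier := {a | ∀ v ∈ V, Ω.form x a v = 0}
  add_mem' ha hb v hv := by simp [ha v hv, hb v hv]
  zero_mem' v _ := by simp
  smul_mem' c a ha v hv := by simp [ha v hv]


theorem isInvertible_form (x : M) : (Ω.form x).IsInvertible := by
  let c : A x ≃L[ℝ] F := (trivializationAt F A x).continuousLinearEquivAt ℝ x
    (FiberBundle.mem_baseSet_trivializationAt' x)
  have : T2Space (A x) := c.toHomeomorph.symm.t2Space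
  have : FiniteDimensional ℝ (A x) := c.symm.toLinearEquiv.finiteDimensional
  let d : (A x →ₗ[ℝ] ℝ) ≃ₗ[ℝ] (A x →L[ℝ] ℝ) := LinearMap.toContinuousLinearMap
  have : FiniteDimensional ℝ (A x →L[ℝ] ℝ) := d.finiteDimensional
  have hinj : Function.Injective (Ω.form x : A x →ₗ[ℝ] (A x →L[ℝ] ℝ)) := by
    rw [← LinearMap.ker_eq_bot, LinearMap.ker_eq_bot']
    intro v hv
    exact Ω.nondegenerate x v fun w => DFunLike.congr_fun hv w
  have hdim : Module.finrank ℝ (A x) = Module.finrank ℝ (A x →L[ℝ] ℝ) := by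
    rw [← d.finrank_eq]; exact Subspace.dual_finrank_eq.symm
  let e := LinearEquiv.ofInjectiveOfFinrankEq (Ω.form x : A x →ₗ[ℝ] (A x →L[ℝ] ℝ)) hinj hdim
  refine ⟨e.toContinuousLinearEquiv, ?_⟩
  ext v w
  rfl

/-- The 1-form `df ∘ ρ` on `A` is smooth. -/
theorem contMDiff_differential_comp_anchor (𝒜 : LieAlgebroid I F A)
    (f : C^∞⟮I, M; 𝓘(ℝ, ℝ), ℝ⟯) :
    ContMDiff I (I.prod 𝓘(ℝ, F →L[ℝ] ℝ)) ∞
      (fun x => TotalSpace.mk' (F →L[ℝ] ℝ) (E := fun x : M => A x →L[ℝ] Bundle.Trivial M ℝ x)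
        x ((show TangentSpace I x →L[ℝ] ℝ from mfderiv I 𝓘(ℝ, ℝ) f x).comp (𝒜.anchor x))) := by
  intro x₀
  rw [contMDiffAt_hom_bundle]
  refine ⟨contMDiffAt_id, ?_⟩
  have h1 := ((contMDiffAt_hom_bundle _).1 (𝒜.contMDiff_anchor x₀)).2
  have h2 := (f.contMDiff x₀).mfderiv_const (m := ∞) (by simp)
  refine (h2.clm_comp h1).congr_of_eventuallyEq ?_
  have hT : (trivializationAt E (TangentSpace I) x₀).baseSet ∈ nhds x₀ :=
    (trivializationAt _ _ _).open_baseSet.mem_nhds (FiberBundle.mem_baseSet_trivializationAt' _)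
  filter_upwards [hT] with x hx
  ext v
  simp [inTangentCoordinates, ContinuousLinearMap.inCoordinates]
  have h := (trivializationAt E (TangentSpace I) x₀).symmL_continuousLinearMapAt (R := ℝ) hx
    (𝒜.anchor x ((trivializationAt F A x₀).symmL ℝ x v))
  exact (congrArg (fun w => (mfderiv I 𝓘(ℝ, ℝ) f x) w) h).symm

/-- Existence and uniqueness of Hamiltonian sections. -/
theorem existsUnique_hamiltonianSection (f : C^∞⟮I, M; 𝓘(ℝ, ℝ), ℝ⟯) :
    ∃! a : Cₛ^∞⟮I; F, A⟯, ∀ (x : M) (v : A x),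
      dirDeriv I f x (𝒜.anchor x v) = Ω.form x (a x) v := by
  let ψ : ∀ x, (A x →L[ℝ] Bundle.Trivial M ℝ x) →L[ℝ] A x := fun x => (Ω.form x).inverse
  let α : ∀ x, A x →L[ℝ] Bundle.Trivial M ℝ x := fun x =>
    (show TangentSpace I x →L[ℝ] ℝ from mfderiv I 𝓘(ℝ, ℝ) f x).comp (𝒜.anchor x)
  have hψ : ContMDiff I (I.prod 𝓘(ℝ, (F →L[ℝ] ℝ) →L[ℝ] F)) ∞
      (fun x => TotalSpace.mk' ((F →L[ℝ] ℝ) →L[ℝ] F)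
        (E := fun x : M => (A x →L[ℝ] Bundle.Trivial M ℝ x) →L[ℝ] A x) x (ψ x)) := by
    intro x₀
    rw [contMDiffAt_hom_bundle]
    refine ⟨contMDiffAt_id, ?_⟩
    have h1 := ((contMDiffAt_hom_bundle _).1 (Ω.contMDiff_form x₀)).2
    have hA : (trivializationAt F A x₀).baseSet ∈ nhds x₀ :=
      (trivializationAt _ _ _).open_baseSet.mem_nhds (FiberBundle.mem_baseSet_trivializationAt' _)
    have hB : (trivializationAt (F →L[ℝ] ℝ) (fun x : M => A x →L[ℝ] Bundle.Trivial M ℝ x)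
        x₀).baseSet ∈ nhds x₀ :=
      (trivializationAt _ _ _).open_baseSet.mem_nhds (FiberBundle.mem_baseSet_trivializationAt' _)
    have h2 : ContMDiffAt I 𝓘(ℝ, (F →L[ℝ] ℝ) →L[ℝ] F) ∞
        (ContinuousLinearMap.inverse ∘ fun x => ContinuousLinearMap.inCoordinates F A (F →L[ℝ] ℝ)
          (fun x : M => A x →L[ℝ] Bundle.Trivial M ℝ x) x₀ x x₀ x (Ω.form x)) x₀ := by
      refine ContMDiffAt.comp x₀ (ContDiffAt.contMDiffAt ?_) h1
      apply ContinuousLinearMap.IsInvertible.contDiffAt_map_inverse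
      rw [ContinuousLinearMap.inCoordinates_eq (mem_of_mem_nhds hA) (mem_of_mem_nhds hB)]
      exact ContinuousLinearMap.isInvertible_equiv.comp
        ((Ω.isInvertible_form x₀).comp ContinuousLinearMap.isInvertible_equiv)
    refine h2.congr_of_eventuallyEq ?_
    filter_upwards [hA, hB] with x hx hx'
    rw [Function.comp_apply, ContinuousLinearMap.inCoordinates_eq hx hx',
      ContinuousLinearMap.inCoordinates_eq hx' hx]
    simp [ψ]
    rfl
  refine ⟨⟨fun x => ψ x (α x), hψ.clm_bundle_apply
    (contMDiff_differential_comp_anchor 𝒜 f)⟩, fun x v => ?_, fun b hb => ?_⟩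
  swap
  · ext x
    obtain ⟨e, he⟩ := Ω.isInvertible_form x
    have h : α x = e (b x) := by
      ext v
      have := hb x v
      rw [← he] at this
      exact this
    change b x = ψ x (α x)
    simp [ψ, ← he, h]
  have h : Ω.form x (ψ x (α x)) = α x := by
    obtain ⟨e, he⟩ := Ω.isInvertible_form x
    simp [ψ, ← he]
  exact (DFunLike.congr_fun h v).symm

/-- The Hamiltonian section of `f`: the (unique) smooth section `a_f` of `A` with
`df(ρ(v)) = Ω(a_f, v)` for all `v`. -/
def hamiltonianSection (f : C^∞⟮I, M; 𝓘(ℝ, ℝ), ℝ⟯) : Cₛ^∞⟮I; F, A⟯ :=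
  (Ω.existsUnique_hamiltonianSection f).exists.choose

/-- The Poisson bracket `{f, g} = Ω(a_f, a_g)`. -/
def poissonBracket (f g : C^∞⟮I, M; 𝓘(ℝ, ℝ), ℝ⟯) (x : M) : ℝ :=
  Ω.form x (Ω.hamiltonianSection f x) (Ω.hamiltonianSection g x)

end SymplecticForm

/-- A compatible triple `(Ω, J, g)`: an almost complex structure `J` and a Riemannian metric `g` on
`A` with `g(Jv, Jw) = g(v, w)` and `Ω(v, w) = g(v, Jw)`. -/
structure CompatibleTriple (𝒜 : LieAlgebroid I F A) where
  /-- the symplectic form -/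
  sympl : 𝒜.SymplecticForm
  /-- the almost complex structure -/
  cplx : AlmostComplexStructure I F A
  /-- the Riemannian metric -/
  metric : ContMDiffRiemannianMetric I ∞ F A
  metric_J_J (x : M) (v w : A x) :
    metric.inner x (cplx.J x v) (cplx.J x w) = metric.inner x v w
  form_eq (x : M) (v w : A x) : sympl.form x v w = metric.inner x v (cplx.J x w)

namespace CompatibleTriple

variable {𝒜 : LieAlgebroid I F A} (T : 𝒜.CompatibleTriple)

/-- `L¹ = L ∩ L^Ω`. -/
def LOne (x : M) : Submodule ℝ (A x) := 𝒜.isotropy x ⊓ T.sympl.complement x (𝒜.isotropy x)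

/-- `E¹ = J(L¹)`. -/
def EOne (x : M) : Submodule ℝ (A x) := (T.LOne x).map (T.cplx.J x : A x →ₗ[ℝ] A x)

/-- `E² = (L + E¹)^Ω`. -/
def ETwo (x : M) : Submodule ℝ (A x) := T.sympl.complement x (𝒜.isotropy x ⊔ T.EOne x)

/-- The symplectic generalized distribution `Λ = ρ(E² + L¹)` on `M`. -/
def distribution (x : M) : Submodule ℝ (TangentSpace I x) :=
  (T.ETwo x ⊔ T.LOne x).map (𝒜.anchor x : A x →ₗ[ℝ] TangentSpace I x)

end CompatibleTriple

end LieAlgebroid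

/-- The injective immersion `ι : N → M` presents its image `O = ι(N)` (with the manifold structure
of `N`) as an integral submanifold of the generalized distribution `Λ`: `T_yO = Λ_y` at every
point `y` of `O`. Neither connectedness nor maximality is asked for, so the maximal connected integral
submanifolds (the leaves of `Λ`) are included. -/
structure IsIntegralSubmanifold {E' : Type*} [NormedAddCommGroup E'] [NormedSpace ℝ E']
    {H' : Type*} [TopologicalSpace H'] (I' : ModelWithCorners ℝ E' H')
    {N : Type*} [TopologicalSpace N] [ChartedSpace H' N]
    (Λ : ∀ x : M, Submodule ℝ (TangentSpace I x)) (ι : N → M) : Prop where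
  contMDiff : ContMDiff I' I ∞ ι
  injective : Function.Injective ι
  injective_mfderiv (q : N) : Function.Injective (mfderiv I' I ι q)
  range_mfderiv (q : N) :
    LinearMap.range (mfderiv I' I ι q : TangentSpace I' q →ₗ[ℝ] TangentSpace I (ι q)) = Λ (ι q)

end LieAlgebroid

end

section LieAlgebroidLemmas

set_option linter.unusedSectionVars false

variable {E : Type*} [NormedAddCommGroup E] [NormedSpace ℝ E] [FiniteDimensional ℝ E]
  {H : Type*} [TopologicalSpace H] {I : ModelWithCorners ℝ E H}
  {M : Type*} [TopologicalSpace M] [ChartedSpace H M] [IsManifold I ∞ M]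
  {F : Type*} [NormedAddCommGroup F] [NormedSpace ℝ F] [FiniteDimensional ℝ F]
  {A : M → Type*} [TopologicalSpace (TotalSpace F A)]
  [∀ x, TopologicalSpace (A x)] [∀ x, AddCommGroup (A x)] [∀ x, Module ℝ (A x)]
  [∀ x, IsTopologicalAddGroup (A x)] [∀ x, ContinuousSMul ℝ (A x)]
  [FiberBundle F A] [VectorBundle ℝ F A] [ContMDiffVectorBundle ∞ F A I]

namespace LieAlgebroid

namespace SymplecticForm

variable {𝒜 : LieAlgebroid I F A} (Ω : 𝒜.SymplecticForm)

theorem form_antisymm (x : M) (v w : A x) : Ω.form x v w = -Ω.form x w v := by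
  have h := Ω.form_self x (v + w)
  simp only [map_add, add_apply, Ω.form_self] at h
  linarith

theorem complement_complement_le (x : M) (W : Submodule ℝ (A x)) :
    Ω.complement x (Ω.complement x W) ≤ W := by
  intro a ha
  by_contra haW
  let c : A x ≃L[ℝ] F := (trivializationAt F A x).continuousLinearEquivAt ℝ x
    (FiberBundle.mem_baseSet_trivializationAt' x)
  have : T2Space (A x) := c.toHomeomorph.symm.t2Space
  have : FiniteDimensional ℝ (A x) := c.symm.toLinearEquiv.finiteDimensional
  obtain ⟨φ, hφa, hφW⟩ := Submodule.exists_le_ker_of_notMem haW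
  obtain ⟨e, he⟩ := Ω.isInvertible_form x
  have hb (v : A x) : Ω.form x (e.symm (LinearMap.toContinuousLinearMap φ)) v = φ v := by
    simp [← he]
  refine hφa ?_
  rw [← hb, form_antisymm, ha _ fun v hv => (hb v).trans (hφW hv), neg_zero]

theorem form_hamiltonianSection (f : C^∞⟮I, M; 𝓘(ℝ, ℝ), ℝ⟯) (x : M)
    (v : A x) : Ω.form x (Ω.hamiltonianSection f x) v = dirDeriv I f x (𝒜.anchor x v) :=
  ((Ω.existsUnique_hamiltonianSection f).exists.choose_spec x v).symm

theorem hamiltonianSection_mem_complement_isotropy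
    (f : C^∞⟮I, M; 𝓘(ℝ, ℝ), ℝ⟯) (x : M) :
    Ω.hamiltonianSection f x ∈ Ω.complement x (𝒜.isotropy x) := by
  intro v hv
  have hv' : 𝒜.anchor x v = 0 := hv
  rw [form_hamiltonianSection, hv']
  exact map_zero (mfderiv I 𝓘(ℝ, ℝ) f x)

theorem poissonBracket_eq_zero_of_mem_isotropy
    (f g : C^∞⟮I, M; 𝓘(ℝ, ℝ), ℝ⟯) (x : M) (hf : Ω.hamiltonianSection f x ∈ 𝒜.isotropy x) :
    Ω.poissonBracket f g x = 0 := by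
  rw [poissonBracket, form_antisymm, Ω.hamiltonianSection_mem_complement_isotropy g x _ hf,
    neg_zero]

end SymplecticForm

namespace CompatibleTriple

variable {𝒜 : LieAlgebroid I F A} (T : 𝒜.CompatibleTriple)

theorem sup_EOne_inf_complement_isotropy_le (x : M) :
    (𝒜.isotropy x ⊔ T.EOne x) ⊓ T.sympl.complement x (𝒜.isotropy x) ≤ 𝒜.isotropy x := by
  rintro a ⟨ha, ha'⟩
  obtain ⟨l, hl, _, ⟨m, hm, rfl⟩, rfl⟩ := Submodule.mem_sup.1 ha
  have h1 : T.sympl.form x l m = 0 := by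
    rw [SymplecticForm.form_antisymm, hm.2 l hl, neg_zero]
  have h2 := ha' m hm.1
  have h3 : T.metric.inner x (T.cplx.J x m) (T.cplx.J x m) = 0 := by
    rw [← T.form_eq]
    simpa [h1] using h2
  have h4 : m = 0 := by
    by_contra hne
    rw [T.metric_J_J] at h3
    exact (T.metric.pos x m hne).ne' h3
  simpa [h4] using hl

theorem hamiltonianSection_mem_isotropy (f : C^∞⟮I, M; 𝓘(ℝ, ℝ), ℝ⟯)
    (x : M) (hf : ∀ v ∈ T.distribution x, dirDeriv I f x v = 0) :
    T.sympl.hamiltonianSection f x ∈ 𝒜.isotropy x := by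
  refine T.sup_EOne_inf_complement_isotropy_le x
    ⟨T.sympl.complement_complement_le x _ fun v hv => ?_,
      T.sympl.hamiltonianSection_mem_complement_isotropy f x⟩
  rw [SymplecticForm.form_hamiltonianSection]
  exact hf _ (Submodule.mem_map_of_mem (Submodule.mem_sup_left hv))

end CompatibleTriple

end LieAlgebroid

theorem IsIntegralSubmanifold.dirDeriv_eq_zero
    {E' : Type*} [NormedAddCommGroup E'] [NormedSpace ℝ E']
    {H' : Type*} [TopologicalSpace H'] {I' : ModelWithCorners ℝ E' H'}
    {N : Type*} [TopologicalSpace N] [ChartedSpace H' N]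
    {Λ : ∀ x : M, Submodule ℝ (TangentSpace I x)} {ι : N → M}
    (hι : IsIntegralSubmanifold I' Λ ι) (f : C^∞⟮I, M; 𝓘(ℝ, ℝ), ℝ⟯) {c : ℝ}
    (hf : ∀ y ∈ Set.range ι, f y = c) (q : N) (v : TangentSpace I (ι q)) (hv : v ∈ Λ (ι q)) :
    dirDeriv I f (ι q) v = 0 := by
  rw [← hι.range_mfderiv q] at hv
  obtain ⟨w, rfl⟩ := hv
  have hconst : f ∘ ι = fun _ => c := funext fun p => hf _ ⟨p, rfl⟩
  have hcomp := mfderiv_comp q (f.contMDiff.mdifferentiable (by simp) (ι q))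
    (hι.contMDiff.mdifferentiable (by simp) q)
  rw [hconst, mfderiv_const] at hcomp
  exact (DFunLike.congr_fun hcomp w).symm

end LieAlgebroidLemmas

theorem mainTheorem10
    {E : Type*} [NormedAddCommGroup E] [NormedSpace ℝ E] [FiniteDimensional ℝ E]
    {M : Type*} [TopologicalSpace M] [ChartedSpace E M] [IsManifold 𝓘(ℝ, E) ∞ M]
    [T2Space M] [SigmaCompactSpace M]
    {F : Type*} [NormedAddCommGroup F] [NormedSpace ℝ F] [FiniteDimensional ℝ F]
    {A : M → Type*} [TopologicalSpace (TotalSpace F A)]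
    [∀ x, TopologicalSpace (A x)] [∀ x, AddCommGroup (A x)] [∀ x, Module ℝ (A x)]
    [∀ x, IsTopologicalAddGroup (A x)] [∀ x, ContinuousSMul ℝ (A x)]
    [FiberBundle F A] [VectorBundle ℝ F A] [ContMDiffVectorBundle ∞ F A 𝓘(ℝ, E)]
    (𝒜 : LieAlgebroid 𝓘(ℝ, E) F A) (T : 𝒜.CompatibleTriple)
    {E' : Type*} [NormedAddCommGroup E'] [NormedSpace ℝ E'] [FiniteDimensional ℝ E']
    {N : Type*} [TopologicalSpace N] [ChartedSpace E' N] [IsManifold 𝓘(ℝ, E') ∞ N]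
    (ι : N → M) (hι : IsIntegralSubmanifold 𝓘(ℝ, E') T.distribution ι)
    (x : M) (hx : x ∈ Set.range ι)
    (f : C^∞⟮𝓘(ℝ, E), M; 𝓘(ℝ, ℝ), ℝ⟯)
    (hf : ∃ c : ℝ, ∀ y ∈ Set.range ι, f y = c) :
    ∀ (g : C^∞⟮𝓘(ℝ, E), M; 𝓘(ℝ, ℝ), ℝ⟯), ∀ y ∈ Set.range ι,
      T.sympl.poissonBracket f g y = 0 := by
  obtain ⟨c, hc⟩ := hf
  rintro g _ ⟨q, rfl⟩
  exact T.sympl.poissonBracket_eq_zero_of_mem_isotropy f g _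
    (T.hamiltonianSection_mem_isotropy f _ (hι.dirDeriv_eq_zero f hc q))
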